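/- For a prime $p$ and an integer $c \ge 1$ let $$I_{p,c} = [p^c,\, p^c + p^{c-1}) \cap \mathbb{Z} = \{p^c, p^c+1, \dots, p^c + p^{c-1} - 1\},$$ and for a positive integer $k$ let $$\#I(k) = \bigl|\{(p,c) : p \text{ prime},\ c \in \mathbb{Z},\ c \ge 1,\ k \in I_{p,c}\}\bigr|$$ be the number of these prime power intervals (Prime Power Swap intervals) that contain $k$. Theorem. There are infinitely many $k$ with $\#I(k) \le 1$. That is, $$\liminf_{k \to \infty} \#I(k) \le 1.$$ -/

import Mathlib

open Filter

/-- The prime power interval `I_{p,c} = [p^c, p^c + p^(c-1))` of positive integers. It is used only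
for `c ≥ 1`, where the subtraction in the exponent is the true one. -/
def primePowerInterval (p c : ℕ) : Set ℕ :=
  Set.Ico (p ^ c) (p ^ c + p ^ (c - 1))

/-- The number of pairs `(p, c)`, with `p` prime and `c` a positive integer, such that `k` lies in
`I_{p,c}`. The cardinality is taken in `ℕ∞`, so that it has no junk value. -/
noncomputable def numPrimePowerIntervals (k : ℕ) : ℕ∞ :=
  {pc : ℕ × ℕ | pc.1.Prime ∧ 1 ≤ pc.2 ∧ k ∈ primePowerInterval pc.1 pc.2}.encard

/-!
The idea is to average over `k` with weight `1 / k`. The interval `I_{p,c}` has `p ^ (c - 1)`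
elements, all at least `p ^ c`, so its total weight is at most `1 / p`; and for a given prime `p`
at most `log N / log p` exponents `c` give an interval that meets `[1, N]`. Hence

  `∑_{k < N} #I(k) / k ≤ log N * ∑_{p ≤ N} 1 / (p * log p)`.

The series `∑ 1 / (p * log p)` over the primes converges to about `1.637`; what matters is that its
sum is less than `2`. If `#I(k)` were at least `2` for all `k ≥ K`, the left side would be at least
`2 * log (N / K)`, and this is too large once `N` is large.

The bound on the series (`sum_inv_prime_mul_log_le`, with the constant `19 / 10`) comes from
the terms with `p ≤ 13`, computed by hand, and a partial summation from `16` on based on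
Chebyshev's estimate `θ x ≤ log 4 * x` (`sum_inv_prime_mul_log_add_le`).
The weighted double counting is `two_mul_sum_inv_le`.
-/

/-! ### The sum of `1 / (p log p)` over the primes -/

theorem sum_primesLE_succ (f : ℕ → ℝ) (n : ℕ) :
    ∑ p ∈ Nat.primesLE (n + 1), f p =
      ∑ p ∈ Nat.primesLE n, f p + if (n + 1).Prime then f (n + 1) else 0 := by
  simp only [Nat.primesLE_eq_filter_Icc_zero, Finset.sum_filter]
  exact Finset.sum_Icc_succ_top (Nat.zero_le _) _

/-- The terms of `∑ 1 / (m log² m)` are dominated by those of a telescoping series. -/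
theorem inv_mul_log_sq_le {n : ℕ} (hn : 2 ≤ n) :
    1 / (((n + 1 : ℕ) : ℝ) * Real.log (n + 1 : ℕ) ^ 2) ≤
      1 / Real.log n - 1 / Real.log (n + 1 : ℕ) := by
  have hn' : (2 : ℝ) ≤ n := by exact_mod_cast hn
  push_cast
  have h1 : 0 < Real.log n := Real.log_pos (by linarith)
  have h2 : Real.log n ≤ Real.log ((n : ℝ) + 1) := Real.log_le_log (by linarith) (by linarith)
  have h3 : 0 < Real.log ((n : ℝ) + 1) := h1.trans_le h2
  have h4 : 1 / ((n : ℝ) + 1) ≤ Real.log ((n : ℝ) + 1) - Real.log n := by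
    rw [← Real.log_div (by linarith) (by linarith)]
    refine le_trans (le_of_eq ?_) (Real.one_sub_inv_le_log_of_pos (by positivity))
    field_simp
    ring
  calc 1 / (((n : ℝ) + 1) * Real.log ((n : ℝ) + 1) ^ 2)
      = 1 / ((n : ℝ) + 1) / Real.log ((n : ℝ) + 1) ^ 2 := by rw [div_div]
    _ ≤ (Real.log ((n : ℝ) + 1) - Real.log n) / Real.log ((n : ℝ) + 1) ^ 2 := by gcongr
    _ ≤ (Real.log ((n : ℝ) + 1) - Real.log n) / (Real.log n * Real.log ((n : ℝ) + 1)) := by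
        apply div_le_div_of_nonneg_left (by linarith) (by positivity)
        rw [sq]
        gcongr
    _ = 1 / Real.log n - 1 / Real.log ((n : ℝ) + 1) := by
        field_simp

/-- Partial summation of `∑ 1 / (p log p) = ∑ log p * 1 / (p log² p)` against Chebyshev's bound
`θ x ≤ log 4 * x`. The term with `θ N` on the left makes the induction on `N` go through. -/
theorem sum_inv_prime_mul_log_add_le {P N : ℕ} (hP : 2 ≤ P) (hN : P ≤ N) :
    ∑ p ∈ Nat.primesLE N, 1 / ((p : ℝ) * Real.log p) +
        (Real.log 4 * N - Chebyshev.theta N) * (1 / ((N : ℝ) * Real.log N ^ 2)) ≤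
      ∑ p ∈ Nat.primesLE P, 1 / ((p : ℝ) * Real.log p) +
        (Real.log 4 * P - Chebyshev.theta P) * (1 / ((P : ℝ) * Real.log P ^ 2)) +
        Real.log 4 * (1 / Real.log P - 1 / Real.log N) := by
  induction N, hN using Nat.le_induction with
  | base => simp
  | succ n hn ih =>
    have hn2 : 2 ≤ n := hP.trans hn
    have hn' : (2 : ℝ) ≤ n := by exact_mod_cast hn2
    have h1 : 0 < Real.log n := Real.log_pos (by linarith)
    have h2 : Real.log n ≤ Real.log (n + 1 : ℕ) :=
      Real.log_le_log (by linarith) (by push_cast; linarith)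
    have hθ : Chebyshev.theta n ≤ Real.log 4 * n := Chebyshev.theta_le_log4_mul_x (by linarith)
    have hg : 1 / (((n + 1 : ℕ) : ℝ) * Real.log (n + 1 : ℕ) ^ 2) ≤
        1 / ((n : ℝ) * Real.log n ^ 2) := by
      apply one_div_le_one_div_of_le (by positivity)
      gcongr
      simp
    have ht := mul_le_mul_of_nonneg_left (inv_mul_log_sq_le hn2)
      (Real.log_nonneg (by norm_num : (1 : ℝ) ≤ 4))
    have hprod := mul_nonneg (sub_nonneg.2 hθ) (sub_nonneg.2 hg)
    -- The term at a prime `p` is the increment `log p` of `θ` times the weight `1 / (p log² p)`.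
    have hstep : (if (n + 1).Prime then 1 / (((n + 1 : ℕ) : ℝ) * Real.log (n + 1 : ℕ)) else 0) =
        (if (n + 1).Prime then Real.log (n + 1 : ℕ) else 0) *
          (1 / (((n + 1 : ℕ) : ℝ) * Real.log (n + 1 : ℕ) ^ 2)) := by
      have : Real.log (n + 1 : ℕ) ≠ 0 := (h1.trans_le h2).ne'
      split_ifs
      · field_simp
      · simp
    have hθs := sum_primesLE_succ (fun p => Real.log p) n
    simp only [← Chebyshev.theta_eq_sum_primesLE_log] at hθs
    have hc : Real.log 4 * ((n + 1 : ℕ) : ℝ) = Real.log 4 * n + Real.log 4 := by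
      push_cast
      ring
    rw [sum_primesLE_succ (fun p => 1 / ((p : ℝ) * Real.log p)), hstep, hθs, hc]
    linarith

theorem div_mul_log_two_le_log {a b p : ℕ} (hb : 0 < b) (h : 2 ^ a ≤ p ^ b) :
    (a / b : ℝ) * Real.log 2 ≤ Real.log p := by
  have hb' : (0 : ℝ) < b := by exact_mod_cast hb
  rw [div_mul_eq_mul_div, div_le_iff₀' hb', ← Real.log_pow, ← Real.log_pow]
  exact Real.log_le_log (by positivity) (by exact_mod_cast h)

theorem inv_mul_log_le {p : ℕ} {r : ℝ} (hp : 0 < p) (hr : 0 < r)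
    (h : r * Real.log 2 ≤ Real.log p) :
    1 / ((p : ℝ) * Real.log p) ≤ 1 / (p * r) / Real.log 2 := by
  have : 0 < Real.log 2 := Real.log_pos (by norm_num)
  rw [div_div]
  apply one_div_le_one_div_of_le (by positivity)
  rw [mul_assoc]
  gcongr

/-- The true value of the infinite sum is about `1.637`. Starting the partial summation at `16`
makes its main term `log 4 / log 16` equal to `1 / 2`. -/
theorem sum_inv_prime_mul_log_le {N : ℕ} (hN : 16 ≤ N) :
    ∑ p ∈ Nat.primesLE N, 1 / ((p : ℝ) * Real.log p) ≤ 19 / 10 := by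
  have h := sum_inv_prime_mul_log_add_le (by norm_num) hN
  have hθ : Chebyshev.theta N ≤ Real.log 4 * N := Chebyshev.theta_le_log4_mul_x (by positivity)
  have hlogN : 0 ≤ 1 / Real.log N := by positivity
  have hdrop : 0 ≤ (Real.log 4 * N - Chebyshev.theta N) * (1 / ((N : ℝ) * Real.log N ^ 2)) :=
    mul_nonneg (sub_nonneg.2 hθ) (by positivity)
  have h16 : Nat.primesLE 16 = {2, 3, 5, 7, 11, 13} := by decide
  have hL := Real.log_two_gt_d9
  have e4 : Real.log 4 = 2 * Real.log 2 := by
    rw [show (4 : ℝ) = 2 ^ 2 by norm_num, Real.log_pow]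
    norm_num
  have e16 : Real.log ((16 : ℕ) : ℝ) = 4 * Real.log 2 := by
    rw [show ((16 : ℕ) : ℝ) = 2 ^ 4 by norm_num, Real.log_pow]
    norm_num
  rw [Chebyshev.theta_eq_sum_primesLE_log 16, h16, e16, e4] at h
  rw [e4] at hdrop
  -- Rational lower bounds for `log p / log 2`, from the inequalities `2 ^ 19 ≤ 3 ^ 12` and so on,
  -- reduce all the numerics to a lower bound for `log 2`.
  have l3 := div_mul_log_two_le_log (a := 19) (b := 12) (p := 3) (by norm_num) (by norm_num)
  have l5 := div_mul_log_two_le_log (a := 16) (b := 7) (p := 5) (by norm_num) (by norm_num)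
  have l7 := div_mul_log_two_le_log (a := 14) (b := 5) (p := 7) (by norm_num) (by norm_num)
  have l11 := div_mul_log_two_le_log (a := 10) (b := 3) (p := 11) (by norm_num) (by norm_num)
  have l13 := div_mul_log_two_le_log (a := 11) (b := 3) (p := 13) (by norm_num) (by norm_num)
  have i2 := inv_mul_log_le (p := 2) (r := 1) (by norm_num) (by norm_num) (by simp)
  have i3 := inv_mul_log_le (by norm_num) (by norm_num) l3
  have i5 := inv_mul_log_le (by norm_num) (by norm_num) l5
  have i7 := inv_mul_log_le (by norm_num) (by norm_num) l7
  have i11 := inv_mul_log_le (by norm_num) (by norm_num) l11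
  have i13 := inv_mul_log_le (by norm_num) (by norm_num) l13
  have hsum : ∀ f : ℕ → ℝ, ∑ p ∈ ({2, 3, 5, 7, 11, 13} : Finset ℕ), f p =
      f 2 + f 3 + f 5 + f 7 + f 11 + f 13 := by
    intro f
    simp [← add_assoc]
  rw [hsum, hsum] at h
  set L := Real.log 2
  have hL0 : 0 < L := by linarith
  -- Here `18` is an upper bound for `32 - θ 16 / log 2`.
  have hθ16 : (2 * L * (16 : ℕ) - (Real.log (2 : ℕ) + Real.log (3 : ℕ) + Real.log (5 : ℕ) +
      Real.log (7 : ℕ) + Real.log (11 : ℕ) + Real.log (13 : ℕ))) *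
        (1 / ((16 : ℕ) * (4 * L) ^ 2)) ≤ 1 / L * (18 / 256) := by
    have e : 1 / L * (18 / 256) = (18 * L) * (1 / ((16 : ℕ) * (4 * L) ^ 2)) := by
      field_simp
      norm_num
    rw [e]
    have l2 : Real.log (2 : ℕ) = L := by norm_num [L]
    gcongr
    push_cast at l2 l3 l5 l7 l11 l13 ⊢
    linarith
  have hmain : 2 * L * (1 / (4 * L) - 1 / Real.log N) ≤ 1 / 2 := by
    have : 2 * L * (1 / (4 * L)) = 1 / 2 := by
      field_simp
      norm_num
    nlinarith
  have hinv : 1 / L ≤ 1 / 0.6931 := one_div_le_one_div_of_le (by norm_num) (by linarith)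
  have hprimes := add_le_add (add_le_add (add_le_add (add_le_add (add_le_add i2 i3) i5) i7) i11) i13
  refine (le_add_of_nonneg_right hdrop).trans
    (h.trans ((add_le_add (add_le_add hprimes hθ16) hmain).trans ?_))
  norm_num at hinv ⊢
  simp only [div_eq_mul_inv _ L]
  linarith

/-! ### Double counting -/

theorem log_sub_log_le_sum_inv {K N : ℕ} (hK : 0 < K) (hN : K ≤ N) :
    Real.log N - Real.log K ≤ ∑ k ∈ Finset.Ico K N, 1 / (k : ℝ) := by
  induction N, hN using Nat.le_induction with
  | base => simp
  | succ n hn ih =>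
    rw [Finset.sum_Ico_succ_top hn]
    have hn0 : (0 : ℝ) < n := by exact_mod_cast hK.trans_le hn
    have h : Real.log (n + 1 : ℕ) - Real.log n ≤ 1 / n := by
      rw [← Real.log_div (by positivity) hn0.ne']
      refine (Real.log_le_sub_one_of_pos (by positivity)).trans (le_of_eq ?_)
      push_cast
      field_simp
      ring
    linarith

/-- The weight `∑ 1 / k` of a prime power interval is at most `1 / p`. -/
theorem sum_inv_primePowerInterval_le {p c : ℕ} (hp : 0 < p) (hc : 1 ≤ c) (s : Finset ℕ)
    (hs : ∀ k ∈ s, k ∈ primePowerInterval p c) : ∑ k ∈ s, 1 / (k : ℝ) ≤ 1 / p := by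
  have hp' : (0 : ℝ) < p := by exact_mod_cast hp
  have hsub : s ⊆ Finset.Ico (p ^ c) (p ^ c + p ^ (c - 1)) := fun k hk =>
    Finset.mem_Ico.2 (hs k hk)
  calc ∑ k ∈ s, 1 / (k : ℝ)
      ≤ ∑ k ∈ Finset.Ico (p ^ c) (p ^ c + p ^ (c - 1)), 1 / (k : ℝ) :=
        Finset.sum_le_sum_of_subset_of_nonneg hsub fun _ _ _ => by positivity
    _ ≤ ∑ _k ∈ Finset.Ico (p ^ c) (p ^ c + p ^ (c - 1)), 1 / (p : ℝ) ^ c := by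
        refine Finset.sum_le_sum fun k hk => ?_
        apply one_div_le_one_div_of_le (by positivity)
        exact_mod_cast (Finset.mem_Ico.1 hk).1
    _ = 1 / p := by
        obtain ⟨d, rfl⟩ := Nat.exists_eq_add_of_le' hc
        simp [pow_succ]
        field_simp

/-- For a given `p`, the exponents `c` with `p ^ c ≤ N` number at most `log N / log p`. -/
theorem card_exponents_le {p N : ℕ} (hp : 2 ≤ p) (hN : 1 ≤ N) :
    (((Finset.Icc 1 N).filter fun c => p ^ c ≤ N).card : ℝ) ≤ Real.log N / Real.log p := by
  have hsub : ((Finset.Icc 1 N).filter fun c => p ^ c ≤ N) ⊆ Finset.Icc 1 (Nat.log p N) := by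
    intro c hc
    rw [Finset.mem_filter, Finset.mem_Icc] at hc
    exact Finset.mem_Icc.2 ⟨hc.1.1, Nat.le_log_of_pow_le hp hc.2⟩
  have hcard := Finset.card_le_card hsub
  rw [Nat.card_Icc, Nat.add_sub_cancel] at hcard
  have hlog : 0 < Real.log p := Real.log_pos (by exact_mod_cast hp)
  rw [le_div_iff₀ hlog]
  calc (((Finset.Icc 1 N).filter fun c => p ^ c ≤ N).card : ℝ) * Real.log p
      ≤ (Nat.log p N : ℝ) * Real.log p := by gcongr
    _ = Real.log ((p : ℝ) ^ Nat.log p N) := (Real.log_pow _ _).symm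
    _ ≤ Real.log N :=
        Real.log_le_log (by positivity) (by exact_mod_cast Nat.pow_log_le_self p (by omega))

/-- The weighted double count of the pairs `(k, I)` with `k` in the prime power interval `I`, in
case every `k ≥ K` lies in at least two intervals. -/
theorem two_mul_sum_inv_le {K N : ℕ} (hN : 1 ≤ N)
    (h : ∀ k, K ≤ k → 1 < numPrimePowerIntervals k) :
    2 * ∑ k ∈ Finset.Ico K N, 1 / (k : ℝ) ≤
      Real.log N * ∑ p ∈ Nat.primesLE N, 1 / ((p : ℝ) * Real.log p) := by
  classical
  set T : Finset (ℕ × ℕ) :=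
    (Nat.primesLE N ×ˢ Finset.Icc 1 N).filter fun pc => pc.1 ^ pc.2 ≤ N with hT
  have hcount : ∀ k ∈ Finset.Ico K N,
      2 ≤ (T.filter fun pc => k ∈ primePowerInterval pc.1 pc.2).card := by
    intro k hk
    rw [Finset.mem_Ico] at hk
    have hset : {pc : ℕ × ℕ | pc.1.Prime ∧ 1 ≤ pc.2 ∧ k ∈ primePowerInterval pc.1 pc.2} ⊆
        ((T.filter fun pc => k ∈ primePowerInterval pc.1 pc.2 : Finset (ℕ × ℕ)) :
          Set (ℕ × ℕ)) := by
      rintro ⟨p, c⟩ ⟨hp, hc, hkI⟩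
      have hle : p ^ c ≤ N := hkI.1.trans hk.2.le
      have hpN : p ≤ N := (Nat.le_self_pow (by omega) p).trans hle
      have hcN : c ≤ N := (Nat.lt_pow_self hp.one_lt).le.trans hle
      simp only [hT, Finset.coe_filter, Finset.mem_filter, Finset.mem_product, Finset.mem_Icc,
        Nat.mem_primesLE, Set.mem_ofPred_eq]
      exact ⟨⟨⟨⟨hpN, hp⟩, hc, hcN⟩, hle⟩, hkI⟩
    have h1 := (h k hk.1).trans_le (Set.encard_le_encard hset)
    rw [Set.encard_coe_eq_coe_finsetCard] at h1
    exact_mod_cast h1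
  calc 2 * ∑ k ∈ Finset.Ico K N, 1 / (k : ℝ)
      = ∑ k ∈ Finset.Ico K N, (2 : ℝ) * (1 / (k : ℝ)) := Finset.mul_sum _ _ _
    _ ≤ ∑ k ∈ Finset.Ico K N,
          ((T.filter fun pc => k ∈ primePowerInterval pc.1 pc.2).card : ℝ) * (1 / (k : ℝ)) := by
        refine Finset.sum_le_sum fun k hk => ?_
        gcongr
        exact_mod_cast hcount k hk
    _ = ∑ k ∈ Finset.Ico K N, ∑ pc ∈ T,
          if k ∈ primePowerInterval pc.1 pc.2 then 1 / (k : ℝ) else 0 := by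
        simp only [← Finset.sum_filter, Finset.sum_const, nsmul_eq_mul]
    _ = ∑ pc ∈ T, ∑ k ∈ (Finset.Ico K N).filter fun k => k ∈ primePowerInterval pc.1 pc.2,
          1 / (k : ℝ) := by
        rw [Finset.sum_comm]
        simp only [Finset.sum_filter]
    _ ≤ ∑ pc ∈ T, 1 / (pc.1 : ℝ) := by
        refine Finset.sum_le_sum fun pc hpc => ?_
        simp only [hT, Finset.mem_filter, Finset.mem_product, Finset.mem_Icc,
          Nat.mem_primesLE] at hpc
        exact sum_inv_primePowerInterval_le hpc.1.1.2.pos hpc.1.2.1 _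
          fun k hk => (Finset.mem_filter.1 hk).2
    _ = ∑ p ∈ Nat.primesLE N,
          (((Finset.Icc 1 N).filter fun c => p ^ c ≤ N).card : ℝ) * (1 / (p : ℝ)) := by
        rw [hT, Finset.sum_filter, Finset.sum_product]
        simp only [← Finset.sum_filter, Finset.sum_const, nsmul_eq_mul]
    _ ≤ ∑ p ∈ Nat.primesLE N, Real.log N / Real.log p * (1 / (p : ℝ)) := by
        refine Finset.sum_le_sum fun p hp => ?_
        gcongr
        exact card_exponents_le (Nat.mem_primesLE.1 hp).2.two_le hN
    _ = Real.log N * ∑ p ∈ Nat.primesLE N, 1 / ((p : ℝ) * Real.log p) := by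
        rw [Finset.mul_sum]
        refine Finset.sum_congr rfl fun p _ => ?_
        rw [div_mul_div_comm, mul_one, mul_one_div, mul_comm (p : ℝ)]

theorem infinite_setOf_numPrimePowerIntervals_le_one :
    {k : ℕ | numPrimePowerIntervals k ≤ 1}.Infinite := by
  rw [← Nat.frequently_atTop_iff_infinite]
  intro hev
  obtain ⟨K₀, hK₀⟩ := eventually_atTop.1 hev
  -- The start is moved to a positive integer, so that `log K` is meaningful.
  set K := K₀ + 1
  have hK : ∀ k, K ≤ k → 1 < numPrimePowerIntervals k := fun k hk =>
    not_le.1 (hK₀ k (by omega))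
  have hlarge : ∀ᶠ N : ℕ in atTop, 20 * Real.log K < Real.log N :=
    (Real.tendsto_log_atTop.comp tendsto_natCast_atTop_atTop).eventually_gt_atTop _
  -- Since `2 - 19 / 10 = 1 / 10`, a contradiction arises as soon as `log N > 20 * log K`.
  obtain ⟨N, hN, hN16, hKN⟩ :=
    (hlarge.and ((eventually_ge_atTop 16).and (eventually_ge_atTop K))).exists
  have h1 := log_sub_log_le_sum_inv (Nat.succ_pos K₀) hKN
  have h2 := two_mul_sum_inv_le (by omega) hK (N := N)
  have h3 := mul_le_mul_of_nonneg_left (sum_inv_prime_mul_log_le hN16) (Real.log_natCast_nonneg N)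
  linarith

theorem mainTheorem3 :
    {k : ℕ | numPrimePowerIntervals k ≤ 1}.Infinite ∧
      liminf (fun k : ℕ => numPrimePowerIntervals k) atTop ≤ 1 :=
  ⟨infinite_setOf_numPrimePowerIntervals_le_one, liminf_le_of_frequently_le'
    (Nat.frequently_atTop_iff_infinite.2 infinite_setOf_numPrimePowerIntervals_le_one)⟩
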